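/- Let $n\ge 1$ and let $G$ be a cycle-plus-triangles graph on $3n$ vertices, that is, a $4$-regular multigraph (parallel edges are allowed) on the vertex set $\{x_1,\dots,x_{3n}\}$ that is the edge-disjoint union of the Hamiltonian cycle $x_1-x_2-\dots-x_{3n}-x_1$ and of $n$ pairwise vertex-disjoint triangles $a_i-b_i-c_i-a_i$, $i=1,\dots,n$ (so the vertex sets of the triangles partition the set of vertices). Then there exists a proper colouring of the vertices of $G$ with the three colours white, blue and red (adjacent vertices receive different colours) such that the subgraph of $G$ induced on the set of all blue and red vertices is connected. -/

import Mathlib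

namespace CyclePlusTriangles

/-- The multigraph `G` is a cycle-plus-triangles graph on `3 * n` vertices: its vertices are
`x 0, …, x (3 * n - 1)` (indexed cyclically), they are also partitioned into `n` triples
`{t (i, 0), t (i, 1), t (i, 2)}`, and its edges are, each listed exactly once and with parallel
edges kept apart, the `3 * n` edges `x i — x (i + 1)` of a Hamiltonian cycle and the `3 * n`
edges `t (i, j) — t (i, j + 1)` of the `n` triangles on the triples. -/
def IsCyclePlusTriangles {α β : Type*} (G : Graph α β) (n : ℕ) : Prop :=
  0 < n ∧
  ∃ (x : ZMod (3 * n) ≃ G.vertexSet) (t : Fin n × ZMod 3 ≃ G.vertexSet)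
    (e : ZMod (3 * n) ⊕ (Fin n × ZMod 3) ≃ G.edgeSet),
    (∀ i : ZMod (3 * n), G.IsLink (e (Sum.inl i)) (x i) (x (i + 1))) ∧
    (∀ (i : Fin n) (j : ZMod 3), G.IsLink (e (Sum.inr (i, j))) (t (i, j)) (t (i, j + 1)))

/-- The three colours. -/
inductive Colour : Type
  | white
  | blue
  | red

/-- A proper colouring of the vertices of a multigraph: the two ends of every edge have different
colours. The values of `c` outside the vertex set play no role. -/
def IsProperColouring {α β : Type*} (G : Graph α β) (c : α → Colour) : Prop :=
  ∀ u v : α, G.Adj u v → c u ≠ c v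

/-- The subgraph of `G` induced on the blue and red vertices. -/
def blueRed {α β : Type*} (G : Graph α β) (c : α → Colour) : Graph α β :=
  G.induce {v | v ∈ G.vertexSet ∧ (c v = Colour.blue ∨ c v = Colour.red)}

/-- A multigraph is connected if it has a vertex and any two vertices are joined by a path;
this depends only on the simple graph that has the same vertices and the same adjacency
between distinct vertices. -/
def IsConnected {α β : Type*} (G : Graph α β) : Prop :=
  G.toSimpleGraph.Connected

end CyclePlusTriangles

namespace CyclePlusTriangles

open Finset Function

/-! ### Cancellation modulo 2 in an expanded product. -/

section Parity

/-! Open the cycle at the edge joining the last vertex to `0`, and count modulo 2 the colourings of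
the resulting path in which every triangle gets all three colours, the first vertex is not `1` and
the last is not `0`. Suppose the count is odd (`sum_perm_path_colouring`). The colourings with both
ends `2` are even in number (interchange `0` and `1`), so some end colours `a ≠ b` occur in an odd
number of colourings, all proper on the whole graph. Interchanging `a` and `b` outside the Kempe
component of `0` is an involution on these, so it has a fixed point: there the vertices coloured `a`
or `b` are connected.

For oddness, give the colours the three nonzero nilpotent 2×2 matrices over the field with two
elements. A product of them along the path is nonzero exactly when consecutive colours differ, so
the count is a matrix entry of a sum that is multilinear and alternating in the three matrices of
each triangle. Hence `upper + lower + 1` may be replaced by `1`. What remains counts the ways to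
delete one vertex per triangle and let `upper` and `lower` alternate along the rest. Modulo 2 this
is a sum over deletions of `∏ i, ∑ j` of inversion parities, and `sum_prod_sum_eq_one` shows that it
is `1`. -/

theorem sum_eq_zero_of_sum_update_eq_zero {ι κ M : Type*} [Fintype ι] [DecidableEq ι] [Fintype κ]
    [AddCommMonoid M] (F : (ι → κ) → M) (i : ι) (h : ∀ w, ∑ a, F (update w i a) = 0) :
    ∑ w, F w = 0 := by
  classical
  rw [← (Equiv.funSplitAt i κ).symm.sum_comp F, Fintype.sum_prod_type_right]
  refine sum_eq_zero fun r _ => ?_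
  rcases isEmpty_or_nonempty κ with hκ | ⟨⟨a₀⟩⟩
  · simp
  · rw [← h ((Equiv.funSplitAt i κ).symm (a₀, r))]
    refine sum_congr rfl fun a _ => congrArg F (funext fun j => ?_)
    by_cases hj : j = i
    · subst hj; simp [Equiv.funSplitAt, Equiv.piSplitAt]
    · simp [Equiv.funSplitAt, Equiv.piSplitAt, hj]

variable {ι κ : Type*} [Fintype ι] [DecidableEq ι] [Fintype κ]
  (B : ι → ι → κ → κ → ZMod 2)

/-- Only the factor of `i` itself involves `w i`, and summing it over `w i` gives zero. -/
theorem sum_prod_eq_zero_of_notMem_range (hB : ∀ i j, i ≠ j → ∀ b, ∑ a, B i j a b = 0)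
    (f : ι → ι) (i : ι) (hi : ∀ j, f j ≠ i) :
    ∑ w : ι → κ, ∏ j, B j (f j) (w j) (w (f j)) = 0 := by
  refine sum_eq_zero_of_sum_update_eq_zero _ i fun w => ?_
  have key : ∀ a, ∏ j, B j (f j) (update w i a j) (update w i a (f j)) =
      B i (f i) a (w (f i)) * ∏ j ∈ univ.erase i, B j (f j) (w j) (w (f j)) := by
    intro a
    rw [← mul_prod_erase univ _ (mem_univ i)]
    simp only [update_self, update_of_ne (hi _)]
    congr 1
    refine prod_congr rfl fun j hj => ?_
    rw [update_of_ne (ne_of_mem_erase hj)]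
  simp_rw [key]
  rw [← sum_mul, hB i (f i) (hi i).symm, zero_mul]

/-- The factors of `i` and `f i` coincide by symmetry and every element of `ZMod 2` is idempotent,
so again `w i` enters through a single factor. -/
theorem sum_prod_eq_zero_of_involutive (hsymm : ∀ i j, i ≠ j → ∀ a b, B i j a b = B j i b a)
    (hB : ∀ i j, i ≠ j → ∀ b, ∑ a, B i j a b = 0)
    (f : ι → ι) (hf : Involutive f) (i : ι) (hi : f i ≠ i) :
    ∑ w : ι → κ, ∏ j, B j (f j) (w j) (w (f j)) = 0 := by
  refine sum_eq_zero_of_sum_update_eq_zero _ i fun w => ?_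
  have hsq : ∀ x : ZMod 2, x * x = x := by decide
  have key : ∀ a, ∏ j, B j (f j) (update w i a j) (update w i a (f j)) =
      B i (f i) a (w (f i)) * ∏ j ∈ (univ.erase i).erase (f i), B j (f j) (w j) (w (f j)) := by
    intro a
    rw [← mul_prod_erase univ _ (mem_univ i),
      ← mul_prod_erase (univ.erase i) _ (mem_erase.2 ⟨hi, mem_univ (f i)⟩), ← mul_assoc]
    simp only [update_self, update_of_ne hi, hf i]
    rw [hsymm (f i) i hi, hsq]
    congr 1
    refine prod_congr rfl fun j hj => ?_
    rw [mem_erase, mem_erase] at hj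
    rw [update_of_ne hj.2.1, update_of_ne]
    rintro rfl
    exact hj.1 (hf j).symm
  simp_rw [key]
  rw [← sum_mul, hB i (f i) hi.symm, zero_mul]

theorem sum_prod_symm (hsymm : ∀ i j, i ≠ j → ∀ a b, B i j a b = B j i b a) (e : Equiv.Perm ι) :
    ∑ w : ι → κ, ∏ j, B j (e.symm j) (w j) (w (e.symm j)) =
      ∑ w : ι → κ, ∏ j, B j (e j) (w j) (w (e j)) := by
  refine sum_congr rfl fun w _ => ?_
  rw [← Equiv.prod_comp e]
  refine prod_congr rfl fun j _ => ?_
  rw [e.symm_apply_apply]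
  by_cases hj : e j = j
  · rw [hj]
  · rw [hsymm _ _ hj]

/-- A parity theorem for alternating families of forms: in the expansion of the product all
terms except that of the identity cancel. -/
theorem sum_prod_sum_eq_one (hκ : Odd (Fintype.card κ))
    (hsymm : ∀ i j, i ≠ j → ∀ a b, B i j a b = B j i b a)
    (hB : ∀ i j, i ≠ j → ∀ b, ∑ a, B i j a b = 0) (hdiag : ∀ i a, B i i a a = 1) :
    ∑ w : ι → κ, ∏ i, ∑ j, B i j (w i) (w j) = 1 := by
  classical
  have hexp : ∀ w : ι → κ, ∏ i, ∑ j, B i j (w i) (w j) =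
      ∑ f : ι → ι, ∏ i, B i (f i) (w i) (w (f i)) := by
    intro w
    rw [prod_univ_sum, Fintype.piFinset_univ]
  simp_rw [hexp]
  rw [sum_comm]
  set S : (ι → ι) → ZMod 2 := fun f => ∑ w : ι → κ, ∏ i, B i (f i) (w i) (w (f i)) with hS
  have hid : S id = 1 := by
    simp only [hS, id, hdiag, prod_const_one, sum_const, card_univ, Fintype.card_fun,
      nsmul_eq_mul, mul_one]
    exact (ZMod.natCast_eq_one_iff_odd).2 (hκ.pow)
  have hperm : ∑ f : ι → ι, S f = ∑ e : Equiv.Perm ι, S e := by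
    symm
    refine sum_of_injOn (fun e : Equiv.Perm ι => (e : ι → ι))
      (fun e _ e' _ h => Equiv.coe_fn_injective h) (by simp) ?_ (fun _ _ => rfl)
    intro f _ hf
    have hns : ¬ Surjective f := by
      intro hs
      exact hf ⟨Equiv.ofBijective f (Finite.surjective_iff_bijective.1 hs), by simp, rfl⟩
    obtain ⟨i, hi⟩ := not_forall.1 hns
    exact sum_prod_eq_zero_of_notMem_range B hB f i (not_exists.1 hi)
  change ∑ f, S f = 1
  rw [hperm, ← hid, ← add_sum_erase univ _ (mem_univ (1 : Equiv.Perm ι))]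
  -- A permutation cancels against its inverse; the self-inverse ones other than the identity have
  -- sum zero individually.
  have hrest : ∑ e ∈ univ.erase (1 : Equiv.Perm ι), S e = 0 := by
    refine sum_involution (fun e _ => e⁻¹) ?_ ?_ ?_ ?_
    · intro e _
      have : S (e⁻¹ : Equiv.Perm ι) = S e := sum_prod_symm B hsymm e
      rw [this]
      exact CharTwo.add_self_eq_zero _
    · intro e he hne heq
      obtain ⟨i, hi⟩ : ∃ i, e i ≠ i := by
        by_contra! h
        exact (mem_erase.1 he).1 (Equiv.ext h)
      refine hne (sum_prod_eq_zero_of_involutive B hsymm hB e (fun j => ?_) i hi)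
      change e⁻¹ = e at heq
      have := e.symm_apply_apply j
      change e⁻¹ (e j) = j at this
      rwa [heq] at this
    · intro e he
      simpa using he
    · intro e _
      exact inv_inv e
  rw [hrest, add_zero]
  rfl

end Parity

/-! ### Alternating sums of multilinear maps in characteristic 2. -/

section Alternating

variable {ι A M : Type*} [Fintype ι] [DecidableEq ι] [AddCommGroup A] [Module (ZMod 2) A]
  [AddCommGroup M] [Module (ZMod 2) M]

/-- The sum of the values of a multilinear map over all ways to assign, for each `i`, the three
vectors `h i` to the three arguments `(i, 0)`, `(i, 1)`, `(i, 2)`. -/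
def permSum (Φ : MultilinearMap (ZMod 2) (fun _ : ι × Fin 3 => A) M) (h : ι → Fin 3 → A) : M :=
  ∑ π : ι → Equiv.Perm (Fin 3), Φ fun p => h p.1 (π p.1 p.2)

variable (Φ : MultilinearMap (ZMod 2) (fun _ : ι × Fin 3 => A) M) (h : ι → Fin 3 → A)

theorem permSum_eq_zero (i : ι) {a b : Fin 3} (hab : a ≠ b) (heq : h i a = h i b) :
    permSum Φ h = 0 := by
  refine sum_involution (fun π _ => update π i (Equiv.swap a b * π i)) ?_ ?_ ?_ ?_
  · intro π _
    have : (fun p : ι × Fin 3 => h p.1 ((update π i (Equiv.swap a b * π i)) p.1 p.2)) =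
        fun p => h p.1 (π p.1 p.2) := by
      funext ⟨j, q⟩
      by_cases hj : j = i
      · subst hj
        simp only [update_self, Equiv.Perm.mul_apply, Equiv.swap_apply_def]
        split_ifs with h1 h2
        · rw [h1, heq]
        · rw [h2, heq]
        · rfl
      · simp only [update_of_ne hj]
    rw [this]
    exact ZModModule.add_self _
  · intro π _ _ hπ
    have := congrFun hπ i
    rw [update_self] at this
    exact hab (Equiv.swap_eq_one_iff.1 (mul_eq_right.1 this))
  · intro π _
    exact mem_univ _
  · intro π _
    simp

theorem permSum_update_add (i : ι) (c : Fin 3) (x y : A) :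
    permSum Φ (update h i (update (h i) c (x + y))) =
      permSum Φ (update h i (update (h i) c x)) + permSum Φ (update h i (update (h i) c y)) := by
  have key : ∀ (z : A) (π : ι → Equiv.Perm (Fin 3)),
      (fun p : ι × Fin 3 => (update h i (update (h i) c z)) p.1 (π p.1 p.2)) =
        update (fun p : ι × Fin 3 => h p.1 (π p.1 p.2)) (i, (π i).symm c) z := by
    intro z π
    funext ⟨j, q⟩
    by_cases hj : j = i
    · subst hj
      by_cases hq : π j q = c
      · subst hq; simp
      · have : (j, q) ≠ (j, (π j).symm c) := by
          intro e
          exact hq (by rw [(Prod.mk.inj e).2, Equiv.apply_symm_apply])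
        simp [update_of_ne this, hq]
    · have : (j, q) ≠ (i, (π i).symm c) := fun e => hj (Prod.mk.inj e).1
      simp [update_of_ne this, update_of_ne hj]
  simp only [permSum, key, MultilinearMap.map_update_add, sum_add_distrib]

/-- As for a determinant, adding two of the three vectors to the third changes nothing. -/
theorem permSum_update_add_add (i : ι) (e f x : A) :
    permSum Φ (update h i ![e, f, e + f + x]) = permSum Φ (update h i ![e, f, x]) := by
  have hv : ∀ y z : A, update ![e, f, y] 2 z = ![e, f, z] := by
    intro y z
    funext q
    fin_cases q <;> simp [update]
  have key : ∀ y z : A, permSum Φ (update h i ![e, f, y + z]) =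
      permSum Φ (update h i ![e, f, y]) + permSum Φ (update h i ![e, f, z]) := by
    intro y z
    have := permSum_update_add Φ (update h i ![e, f, 0]) i 2 y z
    simpa [hv] using this
  rw [key, key, permSum_eq_zero Φ (update h i ![e, f, e]) i (a := 0) (b := 2) (by decide)
    (by simp), permSum_eq_zero Φ (update h i ![e, f, f]) i (a := 1) (b := 2) (by decide)
    (by simp), zero_add, zero_add]

theorem permSum_const_add_add (e f x : A) :
    permSum Φ (fun _ => ![e, f, e + f + x]) = permSum Φ (fun _ => ![e, f, x]) := by
  have key : ∀ s : Finset ι, permSum Φ (fun i => if i ∈ s then ![e, f, e + f + x]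
      else ![e, f, x]) = permSum Φ (fun _ => ![e, f, x]) := by
    intro s
    induction s using Finset.induction_on with
    | empty => simp
    | insert i s hi ih =>
      rw [← ih]
      have h1 : ∀ y : Fin 3 → A, update (fun j => if j ∈ s then ![e, f, e + f + x]
          else ![e, f, x]) i y = fun j => if j = i then y else if j ∈ s then ![e, f, e + f + x]
          else ![e, f, x] := by
        intro y
        funext j
        by_cases hj : j = i <;> simp [hj]
      have h2 := permSum_update_add_add Φ (fun j => if j ∈ s then ![e, f, e + f + x]
          else ![e, f, x]) i e f x
      rw [h1, h1] at h2
      convert h2 using 3 with j j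
      · by_cases hj : j = i <;> simp [hj]
      · by_cases hj : j = i
        · subst hj; simp [hi]
        · simp [hj]
  simpa using key univ

end Alternating

/-! ### Matrix products that detect admissible words. -/

section Matrices

/-- The matrix unit `E₀₁` over the field with two elements. -/
abbrev upper : Matrix (Fin 2) (Fin 2) (ZMod 2) := !![0, 1; 0, 0]

/-- The matrix unit `E₁₀` over the field with two elements. -/
abbrev lower : Matrix (Fin 2) (Fin 2) (ZMod 2) := !![0, 0; 1, 0]

/-- The three nonzero nilpotent matrices over the field with two elements. -/
abbrev nilMatrix : Fin 3 → Matrix (Fin 2) (Fin 2) (ZMod 2) :=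
  ![upper, lower, upper + lower + 1]

/-- A vector that spans the image of `nilMatrix a`. -/
abbrev imageVec : Fin 3 → Fin 2 → ZMod 2 := ![![1, 0], ![0, 1], ![1, 1]]

/-- A linear form with the same kernel as `nilMatrix a`. -/
abbrev kernelForm : Fin 3 → Fin 2 → ZMod 2 := ![![0, 1], ![1, 0], ![1, 1]]

theorem vecMulVec_mul_nilMatrix : ∀ a b d : Fin 3,
    Matrix.vecMulVec (imageVec a) (kernelForm b) * nilMatrix d =
      if b ≠ d then Matrix.vecMulVec (imageVec a) (kernelForm d) else 0 := by
  decide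

theorem prod_nilMatrix {k : ℕ} (c : Fin (k + 1) → Fin 3) :
    (List.ofFn fun i => nilMatrix (c i)).prod =
      if ∀ i : Fin k, c i.castSucc ≠ c i.succ then
        Matrix.vecMulVec (imageVec (c 0)) (kernelForm (c (Fin.last k))) else 0 := by
  induction k with
  | zero =>
    have : ∀ a, nilMatrix a = Matrix.vecMulVec (imageVec a) (kernelForm a) := by decide
    simpa using this (c 0)
  | succ k ih =>
    rw [List.ofFn_succ', List.concat_eq_append, List.prod_append, List.prod_singleton,
      ih fun i => c i.castSucc, ite_mul, vecMulVec_mul_nilMatrix, zero_mul, ← ite_and]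
    refine if_congr ?_ rfl rfl
    rw [Fin.forall_fin_succ' (P := fun i : Fin (k + 1) => c i.castSucc ≠ c i.succ)]
    rfl

theorem prod_nilMatrix_zero_zero {k : ℕ} (c : Fin (k + 1) → Fin 3) :
    (List.ofFn fun i => nilMatrix (c i)).prod 0 0 =
      if (∀ i : Fin k, c i.castSucc ≠ c i.succ) ∧ c 0 ≠ 1 ∧ c (Fin.last k) ≠ 0 then 1 else 0 := by
  have key : ∀ a b, Matrix.vecMulVec (imageVec a) (kernelForm b) 0 0 =
      if a ≠ 1 ∧ b ≠ 0 then 1 else 0 := by decide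
  rw [prod_nilMatrix, apply_ite (fun X : Matrix (Fin 2) (Fin 2) (ZMod 2) => X 0 0), key,
    Matrix.zero_apply, ← ite_and]

/-- A two-state automaton started in state `0`: `upper` moves `0` to `1`, `lower` moves `1` to `0`,
and `1` keeps the state. The state is thus the parity of the non-identity letters read so far. -/
theorem prod_upper_lower_one {m : ℕ} (c : Fin m → Fin 3) (b : Fin 2) :
    (List.ofFn fun i => (![upper, lower, 1] : Fin 3 → _) (c i)).prod 0 b =
      if (∀ i, c i ≠ 2 → (∑ l, if l < i ∧ c l ≠ 2 then (1 : ZMod 2) else 0) = ((c i : ℕ) : ZMod 2))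
        ∧ (∑ l, if c l ≠ 2 then (1 : ZMod 2) else 0) = ((b : ℕ) : ZMod 2)
        then (1 : ZMod 2) else 0 := by
  induction m generalizing b with
  | zero => revert b; decide +revert
  | succ m ih =>
    have key : ∀ (P : Prop) [Decidable P] (s : ZMod 2) (d : Fin 3) (b : Fin 2),
        (∑ j : Fin 2, (if P ∧ s = ((j : ℕ) : ZMod 2) then (1 : ZMod 2) else 0) *
          (![upper, lower, 1] : Fin 3 → Matrix (Fin 2) (Fin 2) (ZMod 2)) d j b) =
        if (P ∧ (d ≠ 2 → s = ((d : ℕ) : ZMod 2))) ∧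
          (s + if d ≠ 2 then (1 : ZMod 2) else 0) = ((b : ℕ) : ZMod 2)
          then 1 else 0 := by
      intro P _
      by_cases hP : P
      · simp only [hP, true_and]
        decide
      · simp [hP]
    rw [List.ofFn_succ', List.concat_eq_append, List.prod_append, List.prod_singleton,
      Matrix.mul_apply]
    simp_rw [ih fun i => c i.castSucc]
    rw [key]
    refine if_congr (and_congr ?_ ?_) rfl rfl
    · rw [Fin.forall_fin_succ']
      simp only [Fin.sum_univ_castSucc, Fin.castSucc_lt_castSucc_iff, Fin.castSucc_lt_last,
        (Fin.castSucc_lt_last _).not_gt, true_and, false_and, if_false, add_zero, lt_irrefl]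
    · rw [Fin.sum_univ_castSucc]

end Matrices

/-! ### Oddness of the number of path colourings. -/

section Count

variable {ι : Type*} {m : ℕ} (pos : ι × Fin 3 ≃ Fin m)

/-- The parity of the number of positions before `k` that remain when position `(j, w j)` is
deleted for each `j`. -/
def stateBefore [Fintype ι] (w : ι → Fin 3) (k : Fin m) : ZMod 2 :=
  ∑ j, ∑ q, if pos (j, q) < k ∧ q ≠ w j then 1 else 0

/-- The parity of the number of inversions between the two legs of `i` other than `a` and the two
legs of `j` other than `b`. -/
def inversionParity (i j : ι) (a b : Fin 3) : ZMod 2 :=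
  ∑ p, ∑ q, if p ≠ a ∧ q ≠ b ∧ pos (j, q) < pos (i, p) then 1 else 0

theorem sum_inversionParity [Fintype ι] (w : ι → Fin 3) (i : ι) :
    ∑ j, inversionParity pos i j (w i) (w j) =
      ∑ p, if p ≠ w i then stateBefore pos w (pos (i, p)) else 0 := by
  simp only [inversionParity, stateBefore]
  rw [sum_comm]
  refine sum_congr rfl fun p _ => ?_
  by_cases hp : p = w i
  · simp [hp]
  · simp [hp, and_comm]

/-- Each leg `p` survives for exactly two of the three choices of `a`. -/
theorem sum_inversionParity_left (i j : ι) (b : Fin 3) :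
    ∑ a, inversionParity pos i j a b = 0 := by
  have key : ∀ x : Fin 3 → ZMod 2, ∑ a, ∑ p, (if p ≠ a then x p else 0) = 0 := by decide
  rw [← key fun p => ∑ q, if q ≠ b ∧ pos (j, q) < pos (i, p) then 1 else 0]
  refine sum_congr rfl fun a _ => sum_congr rfl fun p _ => ?_
  by_cases hp : p = a <;> simp [hp]

/-- The two sides together count all four pairs of remaining legs. -/
theorem inversionParity_symm (i j : ι) (hij : i ≠ j) (a b : Fin 3) :
    inversionParity pos i j a b = inversionParity pos j i b a := by
  have h0 : ∀ a b : Fin 3, ∑ p, ∑ q, (if p ≠ a ∧ q ≠ b then (1 : ZMod 2) else 0) = 0 := by decide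
  rw [← CharTwo.add_eq_zero, ← h0 a b, inversionParity, inversionParity,
    sum_comm (γ := Fin 3) (s := univ) (t := univ) (f := fun p q =>
      if p ≠ b ∧ q ≠ a ∧ pos (i, q) < pos (j, p) then (1 : ZMod 2) else 0), ← sum_add_distrib]
  refine sum_congr rfl fun p _ => ?_
  rw [← sum_add_distrib]
  refine sum_congr rfl fun q _ => ?_
  have hne : pos (i, p) ≠ pos (j, q) := fun h => hij (Prod.mk.inj (pos.injective h)).1
  rcases hne.lt_or_gt with h | h <;> by_cases hp : p = a <;> by_cases hq : q = b <;>
    simp [hp, hq, h, h.not_gt]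

theorem inversionParity_self (i : ι) (a : Fin 3) : inversionParity pos i i a a = 1 := by
  have key : ∀ (a : Fin 3) (r : Fin 3 → Fin 3 → Bool), (∀ p, r p p = false) →
      (∀ p q, p ≠ q → r p q = !(r q p)) →
      ∑ p, ∑ q, (if p ≠ a ∧ q ≠ a ∧ r p q then (1 : ZMod 2) else 0) = 1 := by
    intro a r h1 h2
    have h01 := h2 0 1 (by decide)
    have h02 := h2 0 2 (by decide)
    have h12 := h2 1 2 (by decide)
    simp only [Fin.sum_univ_three, h1, h01, h02, h12]
    revert a
    generalize r 1 0 = x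
    generalize r 2 0 = y
    generalize r 2 1 = z
    revert x y z
    decide
  have := key a (fun p q => decide (pos (i, q) < pos (i, p))) (by simp) (by
    intro p q hpq
    have hne : pos (i, p) ≠ pos (i, q) := fun h => hpq (Prod.mk.inj (pos.injective h)).2
    rcases hne.lt_or_gt with h | h <;> simp [h, h.not_gt])
  simpa [inversionParity] using this

theorem sum_prod_sum_inversionParity [Fintype ι] [DecidableEq ι] :
    ∑ w : ι → Fin 3, ∏ i, ∑ j, inversionParity pos i j (w i) (w j) = 1 := by
  refine sum_prod_sum_eq_one (inversionParity pos) (by decide) (inversionParity_symm pos)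
    (fun i j _ b => sum_inversionParity_left pos i j b) (inversionParity_self pos)

/-- A consistent `σ` exists, and is then unique, exactly when the two remaining values of `t`
differ, that is, when they sum to `1`. -/
theorem sum_perm_consistent (t : Fin 3 → ZMod 2) (a : Fin 3) :
    ∑ σ : Equiv.Perm (Fin 3), (if σ.symm 2 = a then
      if ∀ q, q ≠ a → t q = ((σ q : ℕ) : ZMod 2) then (1 : ZMod 2) else 0 else 0) =
      ∑ q, if q ≠ a then t q else 0 := by
  revert t a
  decide

theorem sum_perm_prod_upper_lower_one [Fintype ι] [DecidableEq ι] :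
    ∑ π : ι → Equiv.Perm (Fin 3), (List.ofFn fun k => (![upper, lower, 1] : Fin 3 → _)
      (π (pos.symm k).1 (pos.symm k).2)).prod 0 0 = 1 := by
  rw [← sum_prod_sum_inversionParity pos]
  have hterm : ∀ π : ι → Equiv.Perm (Fin 3), (List.ofFn fun k => (![upper, lower, 1] : Fin 3 → _)
      (π (pos.symm k).1 (pos.symm k).2)).prod 0 0 =
      ∑ w : ι → Fin 3, ∏ i, if (π i).symm 2 = w i then
        if ∀ q, q ≠ w i → stateBefore pos w (pos (i, q)) = ((π i q : ℕ) : ZMod 2)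
          then (1 : ZMod 2) else 0 else 0 := by
    intro π
    rw [Fintype.sum_eq_single fun i => (π i).symm 2]
    -- Each letter contributes two non-identity matrices, so the final state is `0`.
    · have hlast : (∑ l : Fin m, if π (pos.symm l).1 (pos.symm l).2 ≠ 2 then (1 : ZMod 2) else 0)
          = (((0 : Fin 2) : ℕ) : ZMod 2) := by
        have key : ∀ σ : Equiv.Perm (Fin 3), ∑ q, (if σ q ≠ 2 then (1 : ZMod 2) else 0) = 0 := by
          decide
        rw [← Equiv.sum_comp pos, Fintype.sum_prod_type]
        simp only [Equiv.symm_apply_apply, key]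
        simp
      rw [prod_upper_lower_one]
      simp only [hlast, and_true, if_true]
      rw [Fintype.prod_ite_zero, prod_const_one]
      refine if_congr ?_ rfl rfl
      rw [← pos.forall_congr_right]
      simp only [Equiv.symm_apply_apply, Prod.forall, ne_eq,
        Equiv.eq_symm_apply]
      refine forall₂_congr fun i q => imp_congr_right fun _ => ?_
      rw [← Equiv.sum_comp pos, Fintype.sum_prod_type]
      simp only [stateBefore, Equiv.symm_apply_apply, ne_eq, Equiv.eq_symm_apply]
    · intro w hw
      obtain ⟨i, hi⟩ := Function.ne_iff.1 hw
      exact prod_eq_zero (mem_univ i) (if_neg hi.symm)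
  simp_rw [hterm]
  rw [sum_comm]
  refine sum_congr rfl fun w _ => ?_
  simp_rw [sum_inversionParity, ← sum_perm_consistent]
  rw [prod_univ_sum, Fintype.piFinset_univ]

/-- The number of assignments of three colours to a word in which every letter of `ι` occurs three
times, once in each colour, with distinct colours on consecutive positions and with the first
colour not `1` and the last not `0`, is odd. -/
theorem sum_perm_path_colouring [Fintype ι] [DecidableEq ι] {k : ℕ} (pos : ι × Fin 3 ≃ Fin (k + 1)) :
    ∑ π : ι → Equiv.Perm (Fin 3),
      (if (∀ i : Fin k, π (pos.symm i.castSucc).1 (pos.symm i.castSucc).2 ≠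
          π (pos.symm i.succ).1 (pos.symm i.succ).2) ∧
        π (pos.symm 0).1 (pos.symm 0).2 ≠ 1 ∧
        π (pos.symm (Fin.last k)).1 (pos.symm (Fin.last k)).2 ≠ 0 then (1 : ZMod 2) else 0) = 1 := by
  have h := permSum_const_add_add ((MultilinearMap.mkPiAlgebraFin (ZMod 2) (k + 1)
    (Matrix (Fin 2) (Fin 2) (ZMod 2))).domDomCongr pos.symm) upper lower 1
  have h00 := congrFun (congrFun h 0) 0
  simp only [permSum, Matrix.sum_apply, MultilinearMap.domDomCongr_apply,
    MultilinearMap.mkPiAlgebraFin_apply] at h00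
  refine Eq.trans ?_ (h00.trans (sum_perm_prod_upper_lower_one pos))
  exact sum_congr rfl fun π _ => (prod_nilMatrix_zero_zero fun i =>
    π (pos.symm i).1 (pos.symm i).2).symm

end Count

/-! ### Kempe changes as a parity involution. -/

section Kempe

variable {V : Type*} (H : SimpleGraph V)

/-- The subgraph of the edges of `H` with both ends in the colours `a` and `b`. -/
def kempeGraph (c : V → Fin 3) (a b : Fin 3) : SimpleGraph V where
  Adj x y := H.Adj x y ∧ (c x = a ∨ c x = b) ∧ (c y = a ∨ c y = b)
  symm := ⟨fun _ _ h => ⟨h.1.symm, h.2.2, h.2.1⟩⟩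
  loopless := ⟨fun _ h => h.1.ne rfl⟩

open Classical in
/-- Interchange the colours `a` and `b` outside the Kempe component of `u`. -/
noncomputable def kempeSwap (a b : Fin 3) (u : V) (c : V → Fin 3) (x : V) : Fin 3 :=
  if (kempeGraph H c a b).Reachable u x then c x else Equiv.swap a b (c x)

theorem swap_mem_pair_iff (a b d : Fin 3) :
    (Equiv.swap a b d = a ∨ Equiv.swap a b d = b) ↔ (d = a ∨ d = b) := by
  revert a b d; decide

variable {H} {a b : Fin 3} {u : V} {c : V → Fin 3}

theorem kempeSwap_mem_pair_iff (x : V) :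
    (kempeSwap H a b u c x = a ∨ kempeSwap H a b u c x = b) ↔ (c x = a ∨ c x = b) := by
  rw [kempeSwap]
  split_ifs
  · rfl
  · exact swap_mem_pair_iff a b _

/-- The swap preserves the set of vertices coloured `a` or `b`; this is what makes `kempeSwap` an
involution. -/
theorem kempeGraph_kempeSwap :
    kempeGraph H (kempeSwap H a b u c) a b = kempeGraph H c a b := by
  ext x y
  simp only [kempeGraph, kempeSwap_mem_pair_iff]

theorem kempeSwap_kempeSwap : kempeSwap H a b u (kempeSwap H a b u c) = c := by
  funext x
  rw [kempeSwap, kempeGraph_kempeSwap]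
  by_cases h : (kempeGraph H c a b).Reachable u x <;> simp [kempeSwap, h]

theorem kempeSwap_of_reachable {x : V} (h : (kempeGraph H c a b).Reachable u x) :
    kempeSwap H a b u c x = c x := if_pos h

theorem kempeSwap_proper (hc : ∀ x y, H.Adj x y → c x ≠ c y) (x y : V) (h : H.Adj x y) :
    kempeSwap H a b u c x ≠ kempeSwap H a b u c y := by
  have key : ∀ a b d e : Fin 3, d ≠ e → ¬((d = a ∨ d = b) ∧ (e = a ∨ e = b)) →
      d ≠ Equiv.swap a b e := by decide
  by_cases hxy : (c x = a ∨ c x = b) ∧ (c y = a ∨ c y = b)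
  · have hadj : (kempeGraph H c a b).Adj x y := ⟨h, hxy⟩
    by_cases hx : (kempeGraph H c a b).Reachable u x
    · rw [kempeSwap_of_reachable hx, kempeSwap_of_reachable (hx.trans hadj.reachable)]
      exact hc x y h
    · have hy : ¬ (kempeGraph H c a b).Reachable u y :=
        fun hy => hx (hy.trans hadj.symm.reachable)
      rw [kempeSwap, kempeSwap, if_neg hx, if_neg hy]
      exact (Equiv.injective _).ne (hc x y h)
  · rw [kempeSwap, kempeSwap]
    split_ifs
    · exact hc x y h
    · exact key a b _ _ (hc x y h) hxy
    · exact (key a b _ _ (hc x y h).symm fun h' => hxy h'.symm).symm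
    · exact (Equiv.injective _).ne (hc x y h)

/-- If no proper colouring with colours `a` and `b` on the adjacent vertices `u` and `v` has a
connected Kempe graph, then the number of such colourings is even. -/
theorem sum_colourings_eq_zero [Fintype V] [DecidableEq V] {v : V} (huv : H.Adj u v) (hab : a ≠ b)
    (hdis : ∀ c : V → Fin 3, (∀ x y, H.Adj x y → c x ≠ c y) → c u = a → c v = b →
      ∃ x, (c x = a ∨ c x = b) ∧ ¬ (kempeGraph H c a b).Reachable u x)
    (Q : (V → Fin 3) → Prop) [DecidablePred Q]
    (hQ : ∀ c, Q c ↔ (∀ x y, H.Adj x y → c x ≠ c y) ∧ c u = a ∧ c v = b) :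
    ∑ c : V → Fin 3, (if Q c then (1 : ZMod 2) else 0) = 0 := by
  rw [← sum_filter]
  refine sum_involution (fun c _ => kempeSwap H a b u c) ?_ ?_ ?_ ?_
  · intro _ _
    exact CharTwo.add_self_eq_zero _
  · intro c hc _ heq
    obtain ⟨h1, h2, h3⟩ := (hQ c).1 (mem_filter.1 hc).2
    obtain ⟨x, hx, hux⟩ := hdis c h1 h2 h3
    have key : ∀ a b d : Fin 3, a ≠ b → (d = a ∨ d = b) → Equiv.swap a b d ≠ d := by decide
    have hx' := congrFun heq x
    rw [kempeSwap, if_neg hux] at hx'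
    exact key a b _ hab hx hx'
  · intro c hc
    obtain ⟨h1, h2, h3⟩ := (hQ c).1 (mem_filter.1 hc).2
    have hadj : (kempeGraph H c a b).Adj u v := ⟨huv, Or.inl h2, Or.inr h3⟩
    refine mem_filter.2 ⟨mem_univ _, (hQ _).2 ⟨kempeSwap_proper h1, ?_, ?_⟩⟩
    · rw [kempeSwap_of_reachable (SimpleGraph.Reachable.refl u), h2]
    · rw [kempeSwap_of_reachable hadj.reachable, h3]
  · intro c _
    exact kempeSwap_kempeSwap

end Kempe

/-! ### From the odd path count to a connected colouring. -/

section Word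

variable {ι : Type*} {k : ℕ} (pos : ι × Fin 3 ≃ Fin (k + 1))

/-- The cycle-plus-triangles graph of a cyclic word in which every letter occurs three times. -/
def wordGraph : SimpleGraph (Fin (k + 1)) where
  Adj x y := x ≠ y ∧ ((pos.symm x).1 = (pos.symm y).1 ∨ y = x + 1 ∨ x = y + 1)
  symm := ⟨fun _ _ h => ⟨h.1.symm, h.2.imp Eq.symm Or.symm⟩⟩
  loopless := ⟨fun _ h => h.1 rfl⟩

/-- `hne` takes care of the edge that closes the path to the cycle. -/
theorem wordGraph_proper_iff (c : Fin (k + 1) → Fin 3) (hne : c 0 ≠ c (Fin.last k)) :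
    (∀ x y, (wordGraph pos).Adj x y → c x ≠ c y) ↔
      (∀ i, Injective fun q => c (pos (i, q))) ∧ ∀ i : Fin k, c i.castSucc ≠ c i.succ := by
  constructor
  · intro h
    refine ⟨fun i q q' hq => ?_, fun i => h _ _ ⟨Fin.castSucc_lt_succ.ne, ?_⟩⟩
    · by_contra hqq
      exact h (pos (i, q)) (pos (i, q'))
        ⟨fun e => hqq (Prod.mk.inj (pos.injective e)).2, Or.inl (by simp)⟩ hq
    · exact Or.inr (Or.inl (by simp))
  · rintro ⟨h1, h2⟩
    have hcyc : ∀ x : Fin (k + 1), c x ≠ c (x + 1) := by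
      intro x
      induction x using Fin.lastCases with
      | last => simpa using hne.symm
      | cast i => simpa using h2 i
    rintro x y ⟨hxy, h | rfl | rfl⟩
    · obtain ⟨⟨i, q⟩, rfl⟩ := pos.surjective x
      obtain ⟨⟨j, q'⟩, rfl⟩ := pos.surjective y
      simp only [Equiv.symm_apply_apply] at h
      subst h
      exact (h1 i).ne fun hq => hxy (by rw [hq])
    · exact hcyc x
    · exact (hcyc y).symm

open Classical in
theorem sum_perm_eq_sum_injective [Fintype ι] {m : ℕ} (pos : ι × Fin 3 ≃ Fin m)
    (F : (Fin m → Fin 3) → ZMod 2) :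
    ∑ π : ι → Equiv.Perm (Fin 3), F (fun l => π (pos.symm l).1 (pos.symm l).2) =
      ∑ c : Fin m → Fin 3, if ∀ i, Injective fun q => c (pos (i, q)) then F c else 0 := by
  rw [← sum_filter]
  refine sum_nbij (fun π l => π (pos.symm l).1 (pos.symm l).2) ?_ ?_ ?_ (fun _ _ => rfl)
  · intro π _
    refine mem_filter.2 ⟨mem_univ _, fun i => ?_⟩
    simpa using (π i).injective
  · intro π _ π' _ h
    funext i
    refine Equiv.ext fun q => ?_
    simpa using congrFun h (pos (i, q))
  · intro c hc
    have hc' := (mem_filter.1 hc).2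
    refine ⟨fun i => Equiv.ofBijective _ (Finite.injective_iff_bijective.1 (hc' i)), by simp, ?_⟩
    funext l
    simp

open Classical in
theorem sum_colourings_both_ends_two [Fintype ι] :
    ∑ c : Fin (k + 1) → Fin 3, (if ((∀ i, Injective fun q => c (pos (i, q))) ∧
      ∀ i : Fin k, c i.castSucc ≠ c i.succ) ∧ c 0 = 2 ∧ c (Fin.last k) = 2
        then (1 : ZMod 2) else 0) = 0 := by
  rw [← sum_filter]
  refine sum_involution (fun c _ => Equiv.swap 0 1 ∘ c) ?_ ?_ ?_ ?_
  · intro _ _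
    exact CharTwo.add_self_eq_zero _
  · intro c hc _ heq
    have h1 := (mem_filter.1 hc).2.1.1 (pos.symm 0).1
    have key : ∀ d : Fin 3, Equiv.swap 0 1 d = d → d = 2 := by decide
    have h2 : ∀ l, c l = 2 := fun l => key _ (congrFun heq l)
    have h3 := @h1 0 1 (by simp only [h2])
    exact absurd h3 (by decide)
  · intro c hc
    obtain ⟨⟨h1, h2⟩, h3, h4⟩ := (mem_filter.1 hc).2
    refine mem_filter.2 ⟨mem_univ _, ⟨fun i => (Equiv.injective _).comp (h1 i),
      fun i => (Equiv.injective _).ne (h2 i)⟩, ?_, ?_⟩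
    · simp only [comp_apply, h3]; decide
    · simp only [comp_apply, h4]; decide
  · intro c _
    funext l
    simp

theorem exists_colouring_kempeGraph_connected [Finite ι] :
    ∃ (c : Fin (k + 1) → Fin 3) (a b : Fin 3), a ≠ b ∧
      (∀ x y, (wordGraph pos).Adj x y → c x ≠ c y) ∧ c 0 = a ∧
      ∀ x, (c x = a ∨ c x = b) → (kempeGraph (wordGraph pos) c a b).Reachable 0 x := by
  classical
  have := Fintype.ofFinite ι
  by_contra! hcon
  have hlast : (wordGraph pos).Adj 0 (Fin.last k) := by
    refine ⟨fun h => ?_, Or.inr (Or.inr (by simp))⟩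
    have hk : k = 0 := by simpa using (congrArg Fin.val h).symm
    have hcard := Fintype.card_congr pos
    rw [Fintype.card_prod, Fintype.card_fin, Fintype.card_fin] at hcard
    omega
  have hpair : ∀ a b : Fin 3, a ≠ b → ∑ c : Fin (k + 1) → Fin 3,
      (if ((∀ i, Injective fun q => c (pos (i, q))) ∧
        ∀ i : Fin k, c i.castSucc ≠ c i.succ) ∧ c 0 = a ∧ c (Fin.last k) = b
          then (1 : ZMod 2) else 0) = 0 := by
    intro a b hab
    refine sum_colourings_eq_zero hlast hab (fun c hc h0 _ => hcon c a b hab hc h0) _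
      fun c => and_congr_left fun h => (wordGraph_proper_iff pos c ?_).symm
    rw [h.1, h.2]
    exact hab
  -- The conditions `x ≠ 1` and `y ≠ 0` leave four pairs of end colours, of which only `(2, 2)` has
  -- equal entries.
  have hsplit : ∀ (T P : Prop) [Decidable T] [Decidable P] (x y : Fin 3),
      (if T then if P ∧ x ≠ 1 ∧ y ≠ 0 then (1 : ZMod 2) else 0 else 0) =
        (if (T ∧ P) ∧ x = 0 ∧ y = 1 then 1 else 0) + (if (T ∧ P) ∧ x = 0 ∧ y = 2 then 1 else 0) +
        (if (T ∧ P) ∧ x = 2 ∧ y = 1 then 1 else 0) +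
        if (T ∧ P) ∧ x = 2 ∧ y = 2 then 1 else 0 := by
    intro T P _ _ x y
    by_cases hT : T <;> by_cases hP : P <;> simp only [hT, hP, true_and, false_and, and_false,
      if_true, if_false, add_zero]
    revert x y
    decide
  have hodd := sum_perm_path_colouring pos
  rw [sum_perm_eq_sum_injective pos fun c => if (∀ i : Fin k, c i.castSucc ≠ c i.succ) ∧
    c 0 ≠ 1 ∧ c (Fin.last k) ≠ 0 then 1 else 0] at hodd
  simp only [hsplit, sum_add_distrib] at hodd
  rw [hpair 0 1 (by decide), hpair 0 2 (by decide), hpair 2 1 (by decide),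
    sum_colourings_both_ends_two] at hodd
  exact absurd hodd (by decide)

end Word

/-! ### Transfer to the multigraph. -/

theorem wordGraph_adj_iff {α β : Type*} {G : Graph α β} {n k : ℕ} (hk : k ≠ 0)
    (x : Fin (k + 1) ≃ G.vertexSet) (t : Fin n × Fin 3 ≃ G.vertexSet)
    (e : Fin (k + 1) ⊕ (Fin n × Fin 3) ≃ G.edgeSet)
    (hx : ∀ i, G.IsLink (e (Sum.inl i)) (x i) (x (i + 1)))
    (ht : ∀ i j, G.IsLink (e (Sum.inr (i, j))) (t (i, j)) (t (i, j + 1))) (i j : Fin (k + 1)) :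
    (wordGraph (t.trans x.symm)).Adj i j ↔ G.Adj (x i) (x j) := by
  constructor
  · rintro ⟨hij, h | rfl | rfl⟩
    · obtain ⟨⟨l, q⟩, hi⟩ := (t.trans x.symm).surjective i
      obtain ⟨⟨l', q'⟩, hj⟩ := (t.trans x.symm).surjective j
      rw [← hi, ← hj, Equiv.symm_apply_apply, Equiv.symm_apply_apply] at h
      have hll : l = l' := h
      subst hll
      have hi' : x i = t (l, q) := by rw [← hi]; simp
      have hj' : x j = t (l, q') := by rw [← hj]; simp
      have hqq : q ≠ q' := by
        rintro rfl
        exact hij (hi.symm.trans hj)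
      have key : ∀ q q' : Fin 3, q ≠ q' → q' = q + 1 ∨ q = q' + 1 := by decide
      rw [hi', hj']
      rcases key q q' hqq with rfl | rfl
      · exact (ht l q).adj
      · exact (ht l q').adj.symm
    · exact (hx i).adj
    · exact (hx j).adj.symm
  · rintro ⟨f, hf⟩
    obtain ⟨f', hf'⟩ := e.surjective ⟨f, hf.edge_mem⟩
    obtain rfl : f = e f' := by rw [hf']
    rcases f' with l | ⟨l, q⟩
    · have hne : l ≠ l + 1 := by
        obtain ⟨k, rfl⟩ := Nat.exists_eq_succ_of_ne_zero hk
        simp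
      rcases hf.eq_and_eq_or_eq_and_eq (hx l) with ⟨h1, h2⟩ | ⟨h1, h2⟩
      · rw [Subtype.coe_inj, x.apply_eq_iff_eq] at h1 h2
        subst h1 h2
        exact ⟨hne, Or.inr (Or.inl rfl)⟩
      · rw [Subtype.coe_inj, x.apply_eq_iff_eq] at h1 h2
        subst h1 h2
        exact ⟨hne.symm, Or.inr (Or.inr rfl)⟩
    · have hq : ∀ q : Fin 3, q ≠ q + 1 := by decide
      have hne : t (l, q) ≠ t (l, q + 1) := fun h => hq q (Prod.mk.inj (t.injective h)).2
      rcases hf.eq_and_eq_or_eq_and_eq (ht l q) with ⟨h1, h2⟩ | ⟨h1, h2⟩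
      · rw [Subtype.coe_inj] at h1 h2
        refine ⟨fun h => hne (by rw [← h1, ← h2, h]), Or.inl ?_⟩
        simp [h1, h2]
      · rw [Subtype.coe_inj] at h1 h2
        refine ⟨fun h => hne (by rw [← h1, ← h2, h]), Or.inl ?_⟩
        simp [h1, h2]

theorem exists_wordGraph {α β : Type*} {G : Graph α β} {n : ℕ} (hG : IsCyclePlusTriangles G n) :
    ∃ (k : ℕ) (x : Fin (k + 1) ≃ G.vertexSet) (pos : Fin n × Fin 3 ≃ Fin (k + 1)),
      ∀ i j, (wordGraph pos).Adj i j ↔ G.Adj (x i) (x j) := by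
  obtain ⟨hn, x, t, e, hx, ht⟩ := hG
  obtain ⟨k, hk, hk1⟩ : ∃ k, 3 * n = k + 1 ∧ k ≠ 0 := ⟨3 * n - 1, by omega, by omega⟩
  -- Once the modulus is a successor, `ZMod` is `Fin` by definition.
  generalize 3 * n = m at x e hx hk
  subst hk
  exact ⟨k, x, _, wordGraph_adj_iff hk1 x t e hx ht⟩

end CyclePlusTriangles

open CyclePlusTriangles in
theorem corollary3 {α β : Type*} (G : Graph α β) (n : ℕ)
    (hG : CyclePlusTriangles.IsCyclePlusTriangles G n) :
    ∃ c : α → CyclePlusTriangles.Colour,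
      CyclePlusTriangles.IsProperColouring G c ∧
      CyclePlusTriangles.IsConnected (CyclePlusTriangles.blueRed G c) := by
  classical
  obtain ⟨k, x, pos, hadj⟩ := exists_wordGraph hG
  obtain ⟨c, a, b, hab, hproper, h0, hconn⟩ := exists_colouring_kempeGraph_connected pos
  set τ : Fin 3 → Colour := fun d => if d = a then Colour.blue else
    if d = b then Colour.red else Colour.white with hτ
  have hτinj : Function.Injective τ := by
    intro d d' h
    have key : ∀ a b d d' : Fin 3, a ≠ b → d ≠ a → d ≠ b → d' ≠ a → d' ≠ b → d = d' := by decide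
    simp only [hτ] at h
    split_ifs at h <;> first | simp_all; done | exact key a b d d' hab ‹_› ‹_› ‹_› ‹_›
  have hτbr : ∀ d, (τ d = Colour.blue ∨ τ d = Colour.red) ↔ (d = a ∨ d = b) := by
    intro d
    simp only [hτ]
    split_ifs with h1 h2 <;> simp [*]
  set C : α → Colour := fun v => if h : v ∈ G.vertexSet then τ (c (x.symm ⟨v, h⟩))
    else Colour.white with hC
  have hCx : ∀ i, C (x i) = τ (c i) := by
    intro i
    simp [hC]
  refine ⟨C, ?_, ?_⟩
  · intro u v huv
    obtain ⟨i, hi⟩ := x.surjective ⟨u, huv.left_mem⟩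
    obtain ⟨j, hj⟩ := x.surjective ⟨v, huv.right_mem⟩
    have hu : u = x i := by rw [hi]
    have hv : v = x j := by rw [hj]
    subst hu hv
    rw [hCx, hCx]
    exact hτinj.ne (hproper i j ((hadj i j).2 huv))
  · have hmem : ∀ i, (c i = a ∨ c i = b) → ((x i : α)) ∈ (blueRed G C).vertexSet := by
      intro i hi
      exact ⟨(x i).2, by rw [hCx]; exact (hτbr _).2 hi⟩
    have hreach : ∀ i (hi : c i = a ∨ c i = b), (blueRed G C).toSimpleGraph.Reachable
        ⟨x 0, hmem 0 (Or.inl h0)⟩ ⟨x i, hmem i hi⟩ := by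
      intro i hi
      have hwalk := (SimpleGraph.reachable_iff_reflTransGen _ _).1 (hconn i hi)
      revert hi
      induction hwalk with
      | refl => exact fun _ => SimpleGraph.Reachable.refl _
      | tail _ hstep ih =>
        intro hi
        refine (ih hstep.2.1).trans (SimpleGraph.Adj.reachable ⟨?_, ?_⟩)
        · intro h
          exact hstep.1.ne (x.injective (Subtype.ext (Subtype.mk.inj h)))
        · obtain ⟨f, hf⟩ := (hadj _ _).1 hstep.1
          exact ⟨f, hf, hmem _ hstep.2.1, hmem _ hi⟩
    refine (SimpleGraph.connected_iff_exists_forall_reachable _).2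
      ⟨⟨x 0, hmem 0 (Or.inl h0)⟩, ?_⟩
    rintro ⟨v, hv, hcol⟩
    obtain ⟨i, hi⟩ := x.surjective ⟨v, hv⟩
    have hvi : v = x i := by rw [hi]
    subst hvi
    rw [hCx] at hcol
    exact hreach i ((hτbr _).1 hcol)
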